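/- Let $\mathfrak A$ be a (not necessarily unital) $C^*$-algebra and let $H,K,E$ be Hilbert $\mathfrak A$-modules. Write $\mathcal L(H,K)$ for the set of adjointable operators from $H$ to $K$, $\mathcal L(H)=\mathcal L(H,H)$, $I_H$ for the identity operator on $H$, and $\mathcal R(T)$ for the range of $T$. The Moore–Penrose inverse $T^\dagger$ of $T\in\mathcal L(H,K)$, if it exists, is the unique $X\in\mathcal L(K,H)$ with $TXT=T$, $XTX=X$, $(TX)^*=TX$, $(XT)^*=XT$; in that case $T$ is called M-P invertible. An element of $\mathcal L(K)$ is called positive definite if it is self-adjoint, positive in the $C^*$-algebra $\mathcal L(K)$, and invertible in $\mathcal L(K)$. Let $A\in\mathcal L(H,K)$ and $B\in\mathcal L(H,E)$ be such that $(\mathcal R(A^*),\mathcal R(B^*))$ is a separated pair, that is, $$\mathcal R(A^*)\cap\mathcal R(B^*)=\{0\}\quad\text{and}\quad \mathcal R(A^*)+\mathcal R(B^*)\ \text{is closed in } H.$$ Then for all positive definite operators $V\in\mathcal L(K)$ and $W\in\mathcal L(E)$, the operators $A$, $B$, $A^*VA$ and $A^*VA+B^*WB$ are M-P invertible, $2I_H-A^\dagger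 A-B^\dagger B$ is invertible in $\mathcal L(H)$, and $$(A^*VA+B^*WB)^\dagger A^*V=(A^*VA)^\dagger A^*V-(I_H-A^\dagger A)\,\Pi,$$ where $\Pi\in\mathcal L(K,H)$ is defined by $$\Pi=(2I_H-A^\dagger A-B^\dagger B)^{-1}(A^*VA)^\dagger A^*V.$$ -/

import Mathlib

open scoped Pointwise

/-- `AdjointableMap 𝔄 H K` is the set `𝓛(H, K)` of adjointable operators between Hilbert
`𝔄`-modules: maps `T : H → K` for which there is a map `T⋆ : K → H` with
`⟪T x, y⟫ = ⟪x, T⋆ y⟫` for all `x`, `y`.  Such a `T` is automatically linear (see `map_add`,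
`map_smul`, `map_smul_complex`) and bounded, and `T⋆` is uniquely determined by `T`
(see `ext`), so that carrying it as a field adds no data. -/
structure AdjointableMap (𝔄 H K : Type*) [Inner 𝔄 H] [Inner 𝔄 K] where
  /-- the operator -/
  toFun : H → K
  /-- the adjoint of the operator -/
  adjFun : K → H
  inner_toFun : ∀ x y, inner 𝔄 (toFun x) y = inner 𝔄 x (adjFun y)

namespace AdjointableMap

section

variable {𝔄 H K E F : Type*} [NonUnitalCStarAlgebra 𝔄] [PartialOrder 𝔄]
  [NormedAddCommGroup H] [NormedSpace ℂ H] [SMul 𝔄 H] [CStarModule 𝔄 H]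
  [NormedAddCommGroup K] [NormedSpace ℂ K] [SMul 𝔄 K] [CStarModule 𝔄 K]
  [NormedAddCommGroup E] [NormedSpace ℂ E] [SMul 𝔄 E] [CStarModule 𝔄 E]
  [NormedAddCommGroup F] [NormedSpace ℂ F] [SMul 𝔄 F] [CStarModule 𝔄 F]

instance : CoeFun (AdjointableMap 𝔄 H K) (fun _ => H → K) := ⟨toFun⟩

variable (𝔄) in
theorem eq_of_inner_left {y z : H} (h : ∀ x : H, inner 𝔄 x y = inner 𝔄 x z) : y = z := by
  have h1 : inner 𝔄 (y - z) (y - z) = 0 := by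
    rw [CStarModule.inner_sub_right, h, sub_self]
  exact sub_eq_zero.mp (CStarModule.inner_self.mp h1)

/-- The Hermitian adjoint `T⋆`. -/
def adjoint (T : AdjointableMap 𝔄 H K) : AdjointableMap 𝔄 K H where
  toFun := T.adjFun
  adjFun := T.toFun
  inner_toFun x y := by
    rw [← CStarModule.star_inner y, ← T.inner_toFun, CStarModule.star_inner]

theorem inner_left (T : AdjointableMap 𝔄 H K) (x : H) (y : K) :
    inner 𝔄 (T x) y = inner 𝔄 x (T.adjoint y) := T.inner_toFun x y

theorem inner_right (T : AdjointableMap 𝔄 H K) (x : K) (y : H) :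
    inner 𝔄 x (T y) = inner 𝔄 (T.adjoint x) y := (T.adjoint.inner_toFun x y).symm

@[ext]
theorem ext {T S : AdjointableMap 𝔄 H K} (h : ∀ x, T x = S x) : T = S := by
  have h1 : T.toFun = S.toFun := funext h
  have h2 : T.adjFun = S.adjFun := by
    funext y
    refine eq_of_inner_left 𝔄 fun x => ?_
    rw [← T.inner_toFun, ← S.inner_toFun, h1]
  cases T
  cases S
  simp_all

theorem map_add (T : AdjointableMap 𝔄 H K) (x y : H) : T (x + y) = T x + T y :=
  eq_of_inner_left 𝔄 fun z => by
    simp only [inner_right, CStarModule.inner_add_right]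

theorem map_smul (T : AdjointableMap 𝔄 H K) (a : 𝔄) (x : H) : T (a • x) = a • T x :=
  eq_of_inner_left 𝔄 fun z => by
    simp only [inner_right, CStarModule.inner_op_smul_right]

theorem map_smul_complex (T : AdjointableMap 𝔄 H K) (c : ℂ) (x : H) : T (c • x) = c • T x :=
  eq_of_inner_left 𝔄 fun z => by
    simp only [inner_right, CStarModule.inner_smul_right_complex]

theorem map_zero (T : AdjointableMap 𝔄 H K) : T 0 = 0 := by
  simpa using T.map_smul_complex 0 0

theorem map_neg (T : AdjointableMap 𝔄 H K) (x : H) : T (-x) = -T x := by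
  simpa using T.map_smul_complex (-1) x

@[simp] theorem adjoint_adjoint (T : AdjointableMap 𝔄 H K) : T.adjoint.adjoint = T := rfl

/-- Composition of adjointable operators, with `(S T)⋆ = T⋆ S⋆`. -/
def comp (S : AdjointableMap 𝔄 K E) (T : AdjointableMap 𝔄 H K) : AdjointableMap 𝔄 H E where
  toFun x := S (T x)
  adjFun y := T.adjoint (S.adjoint y)
  inner_toFun x y := by rw [inner_left, inner_left]

instance : Zero (AdjointableMap 𝔄 H K) where
  zero :=
    { toFun := fun _ => 0
      adjFun := fun _ => 0
      inner_toFun := fun x y => by simp }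

instance : Add (AdjointableMap 𝔄 H K) where
  add S T :=
    { toFun := fun x => S x + T x
      adjFun := fun y => S.adjoint y + T.adjoint y
      inner_toFun := fun x y => by simp [inner_left] }

instance : Neg (AdjointableMap 𝔄 H K) where
  neg S :=
    { toFun := fun x => -S x
      adjFun := fun y => -S.adjoint y
      inner_toFun := fun x y => by simp [inner_left] }

@[simp] theorem zero_apply (x : H) : (0 : AdjointableMap 𝔄 H K) x = 0 := rfl
@[simp] theorem add_apply (S T : AdjointableMap 𝔄 H K) (x : H) : (S + T) x = S x + T x := rfl
@[simp] theorem neg_apply (S : AdjointableMap 𝔄 H K) (x : H) : (-S) x = -S x := rfl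
@[simp] theorem comp_apply (S : AdjointableMap 𝔄 K E) (T : AdjointableMap 𝔄 H K) (x : H) :
    S.comp T x = S (T x) := rfl

/-- `𝓛(H, K)` is an additive group under pointwise addition. -/
instance : AddCommGroup (AdjointableMap 𝔄 H K) where
  add_assoc _ _ _ := ext fun _ => add_assoc _ _ _
  zero_add _ := ext fun _ => zero_add _
  add_zero _ := ext fun _ => add_zero _
  add_comm _ _ := ext fun _ => add_comm _ _
  neg_add_cancel _ := ext fun _ => neg_add_cancel _
  nsmul := nsmulRec
  zsmul := zsmulRec

instance : One (AdjointableMap 𝔄 H H) where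
  one :=
    { toFun := fun x => x
      adjFun := fun y => y
      inner_toFun := fun _ _ => rfl }

instance : Mul (AdjointableMap 𝔄 H H) where
  mul := comp

@[simp] theorem one_apply (x : H) : (1 : AdjointableMap 𝔄 H H) x = x := rfl
@[simp] theorem mul_apply (S T : AdjointableMap 𝔄 H H) (x : H) : (S * T) x = S (T x) := rfl
theorem mul_eq_comp (S T : AdjointableMap 𝔄 H H) : S * T = S.comp T := rfl
@[simp] theorem sub_apply (S T : AdjointableMap 𝔄 H K) (x : H) : (S - T) x = S x - T x := by
  rw [sub_eq_add_neg, sub_eq_add_neg, add_apply, neg_apply]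

/-- `𝓛(H) = 𝓛(H, H)` is a ring under composition, with unit the identity operator. -/
instance : Ring (AdjointableMap 𝔄 H H) where
  left_distrib S _ _ := ext fun _ => S.map_add _ _
  right_distrib _ _ _ := ext fun _ => rfl
  zero_mul _ := ext fun _ => rfl
  mul_zero S := ext fun _ => S.map_zero
  mul_assoc _ _ _ := ext fun _ => rfl
  one_mul _ := ext fun _ => rfl
  mul_one _ := ext fun _ => rfl
  neg_add_cancel := neg_add_cancel
  zsmul := zsmulRec

/-- `𝓛(H)` is a `⋆`-ring, the involution being the adjoint. -/
instance : StarRing (AdjointableMap 𝔄 H H) where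
  star := adjoint
  star_involutive _ := rfl
  star_mul _ _ := rfl
  star_add _ _ := rfl

theorem star_eq_adjoint (S : AdjointableMap 𝔄 H H) : star S = S.adjoint := rfl

/-- Positive elements of the `C⋆`-algebra `𝓛(H)`: those of the form `S⋆ S`. -/
def IsPositive (T : AdjointableMap 𝔄 H H) : Prop :=
  ∃ S : AdjointableMap 𝔄 H H, T = star S * S

/-- A positive definite operator: self-adjoint, invertible in `𝓛(H)`, and positive. -/
structure IsPosDef (T : AdjointableMap 𝔄 H H) : Prop where
  isSelfAdjoint : IsSelfAdjoint T
  isUnit : IsUnit T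
  isPositive : T.IsPositive

/-- `X` is a Moore-Penrose inverse of `T`. -/
structure IsMPInverse (T : AdjointableMap 𝔄 H K) (X : AdjointableMap 𝔄 K H) : Prop where
  comp_comp_self : (T.comp X).comp T = T
  self_comp_comp : (X.comp T).comp X = X
  adjoint_comp_right : (T.comp X).adjoint = T.comp X
  adjoint_comp_left : (X.comp T).adjoint = X.comp T

/-- `T` is M-P invertible: it has a Moore-Penrose inverse in `𝓛(K, H)`. -/
def IsMPInvertible (T : AdjointableMap 𝔄 H K) : Prop :=
  ∃ X : AdjointableMap 𝔄 K H, T.IsMPInverse X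

theorem comp_assoc (R : AdjointableMap 𝔄 E F) (S : AdjointableMap 𝔄 K E)
    (T : AdjointableMap 𝔄 H K) : (R.comp S).comp T = R.comp (S.comp T) := rfl

theorem adjoint_comp (S : AdjointableMap 𝔄 K E) (T : AdjointableMap 𝔄 H K) :
    (S.comp T).adjoint = T.adjoint.comp S.adjoint := rfl

/-- The Moore-Penrose inverse is unique. -/
theorem IsMPInverse.unique {T : AdjointableMap 𝔄 H K} {X Y : AdjointableMap 𝔄 K H}
    (hX : T.IsMPInverse X) (hY : T.IsMPInverse Y) : X = Y := by
  have h1 : T.comp X = T.comp Y := by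
    calc T.comp X = ((T.comp Y).comp T).comp X := by rw [hY.comp_comp_self]
      _ = (T.comp Y).adjoint.comp (T.comp X).adjoint := by
          rw [hX.adjoint_comp_right, hY.adjoint_comp_right, comp_assoc]
      _ = (((T.comp X).comp T).comp Y).adjoint := rfl
      _ = T.comp Y := by rw [hX.comp_comp_self, hY.adjoint_comp_right]
  have h2 : X.comp T = Y.comp T := by
    calc X.comp T = X.comp ((T.comp Y).comp T) := by rw [hY.comp_comp_self]
      _ = (X.comp T).adjoint.comp (Y.comp T).adjoint := by
          rw [hX.adjoint_comp_left, hY.adjoint_comp_left]; rfl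
      _ = (Y.comp ((T.comp X).comp T)).adjoint := rfl
      _ = Y.comp T := by rw [hX.comp_comp_self, hY.adjoint_comp_left]
  calc X = (X.comp T).comp X := hX.self_comp_comp.symm
    _ = Y.comp (T.comp X) := by rw [h2]; rfl
    _ = (Y.comp T).comp Y := by rw [h1]; rfl
    _ = Y := hY.self_comp_comp

open Classical in
/-- The Moore-Penrose inverse `T†` of an M-P invertible operator (and `0` otherwise). -/
noncomputable def mpInv (T : AdjointableMap 𝔄 H K) : AdjointableMap 𝔄 K H :=
  if h : T.IsMPInvertible then h.choose else 0

theorem IsMPInvertible.isMPInverse_mpInv {T : AdjointableMap 𝔄 H K} (h : T.IsMPInvertible) :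
    T.IsMPInverse T.mpInv := by
  rw [mpInv, dif_pos h]
  exact h.choose_spec

/-- `(R(A⋆), R(B⋆))` is a separated pair: `R(A⋆) ∩ R(B⋆) = {0}` and `R(A⋆) + R(B⋆)` is closed. -/
def IsSeparatedPair (A : AdjointableMap 𝔄 H K) (B : AdjointableMap 𝔄 H E) : Prop :=
  Set.range A.adjoint ∩ Set.range B.adjoint = {0} ∧
    IsClosed (Set.range A.adjoint + Set.range B.adjoint)

end

end AdjointableMap

infixr:80 " ∘ₐ " => AdjointableMap.comp

/-!
Let `P = A† A` and `Q = B† B` be the orthogonal projections onto `R(A⋆)` and `R(B⋆)`. Separation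
bounds `‖P x‖` by a multiple of `‖P x - Q x‖`, while `⟪x, (2 - P - Q) x⟫` is the sum of the inner
squares of `(1 - P) x` and `(1 - Q) x`. Hence `2 - P - Q` is coercive, and therefore invertible.

The operator `N = (1 - Q) (2 - P - Q)⁻¹ = 1 - (1 - P) (2 - P - Q)⁻¹` satisfies `P N = P` and
`Q N = 0`. So `(G₁ + G₂) N = G₁` whenever `G₁` and `G₂` are self-adjoint with the ranges of `P` and
`Q`; in particular `G₁ + G₂` has the closed range `R(P) + R(Q)`. The projection
`(G₁ + G₂)† (G₁ + G₂)` fixes `R(P)` and `R(Q)`, so it commutes with `N`, and multiplying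
`(G₁ + G₂) N = G₁` by `(G₁ + G₂)†` gives `(G₁ + G₂)† G₁ = N P`. The formula is the case
`G₁ = A⋆ V A`, `G₂ = B⋆ W B`.
-/

theorem le_of_sq_le_mul {a b : ℝ} (hb : 0 ≤ b) (h : a ^ 2 ≤ a * b) : a ≤ b := by
  by_contra! hlt
  nlinarith

theorem norm_le_of_norm_le_mul_norm_sub {X : Type*} [SeminormedAddCommGroup X] {a b : X} {C : ℝ}
    (hC₀ : 0 ≤ C) (h : ‖a‖ ≤ C * ‖a - b‖) (x : X) :
    ‖x‖ ≤ (1 + C) * ‖x - a‖ + C * ‖x - b‖ := by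
  calc ‖x‖ ≤ ‖x - a‖ + ‖a‖ := norm_le_norm_sub_add x a
    _ ≤ ‖x - a‖ + C * (‖x - b‖ + ‖x - a‖) := by
      refine add_le_add_right (h.trans ?_) _
      rw [← sub_sub_sub_cancel_left b a x]
      gcongr
      exact norm_sub_le _ _
    _ = (1 + C) * ‖x - a‖ + C * ‖x - b‖ := by ring

section ContinuityMethod

variable {R X : Type*} [NormedRing R] [HasSummableGeomSeries R] [TopologicalSpace X]

theorem isUnit_of_norm_inv_mul_norm_sub_lt_one {a : R} (u : Rˣ) (h : ‖(↑u⁻¹ : R)‖ * ‖u - a‖ < 1) :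
    IsUnit a := by
  have ha : a = u * (1 - ↑u⁻¹ * (u - a)) := by
    rw [mul_sub, mul_one, Units.mul_inv_cancel_left, sub_sub_cancel]
  rw [ha]
  exact u.isUnit.mul (isUnit_one_sub_of_norm_lt_one ((norm_mul_le _ _).trans_lt h))

theorem isClosed_setOf_isUnit_of_norm_inv_le {g : X → R} (hg : Continuous g) {C : ℝ}
    (hC : ∀ x (u : Rˣ), ↑u = g x → ‖(↑u⁻¹ : R)‖ ≤ C) : IsClosed {x | IsUnit (g x)} := by
  refine isClosed_of_closure_subset fun x hx => ?_
  have hnear : ∀ᶠ y in nhds x, C * ‖g y - g x‖ < 1 :=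
    ContinuousAt.eventually_lt (by fun_prop) continuousAt_const (by simp)
  obtain ⟨y, hy, u, hu⟩ := mem_closure_iff_nhds.mp hx _ hnear
  refine isUnit_of_norm_inv_mul_norm_sub_lt_one u (lt_of_le_of_lt ?_ hy)
  rw [hu]
  gcongr
  exact hC y u hu

theorem isUnit_of_preconnectedSpace_of_norm_inv_le [PreconnectedSpace X] {g : X → R}
    (hg : Continuous g) {C : ℝ} (hC : ∀ x (u : Rˣ), ↑u = g x → ‖(↑u⁻¹ : R)‖ ≤ C) {x₀ : X}
    (hx₀ : IsUnit (g x₀)) (x : X) : IsUnit (g x) := by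
  have hclopen : IsClopen {x | IsUnit (g x)} :=
    ⟨isClosed_setOf_isUnit_of_norm_inv_le hg hC, Units.isOpen.preimage hg⟩
  have huniv := hclopen.eq_univ ⟨x₀, hx₀⟩
  exact huniv.ge (Set.mem_univ x)

end ContinuityMethod

section Banach

variable {𝕜 X Y Z : Type*} [NontriviallyNormedField 𝕜]
  [NormedAddCommGroup X] [NormedSpace 𝕜 X]
  [NormedAddCommGroup Y] [NormedSpace 𝕜 Y]
  [NormedAddCommGroup Z] [NormedSpace 𝕜 Z]

theorem norm_units_inv_le_of_forall_norm_le (u : (X →L[𝕜] X)ˣ) {C : ℝ} (hC₀ : 0 ≤ C)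
    (hC : ∀ x, ‖x‖ ≤ C * ‖(u : X →L[𝕜] X) x‖) : ‖(↑u⁻¹ : X →L[𝕜] X)‖ ≤ C := by
  refine ContinuousLinearMap.opNorm_le_bound _ hC₀ fun x => (hC _).trans_eq ?_
  rw [← mul_apply_eq_comp, Units.mul_inv, one_apply_eq_self]

theorem isUnit_of_forall_norm_le_mul_norm_add_smul {V : Type*} [NormedAddCommGroup V]
    [NormedSpace ℂ V] [CompleteSpace V] {S : V →L[ℂ] V} {C : ℝ} (hC₀ : 0 ≤ C)
    (hC : ∀ (t : NNReal) (x : V), ‖x‖ ≤ C * ‖S x + (t : ℂ) • x‖) : IsUnit S := by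
  let g : NNReal → V →L[ℂ] V := fun t => S + algebraMap ℂ _ t
  have hg : Continuous g := by fun_prop
  have hbound (t : NNReal) (u : (V →L[ℂ] V)ˣ) (hu : ↑u = g t) : ‖(↑u⁻¹ : V →L[ℂ] V)‖ ≤ C :=
    norm_units_inv_le_of_forall_norm_le u hC₀ (hu ▸ hC t)
  have hlarge : IsUnit (g (‖S‖₊ * ‖(1 : V →L[ℂ] V)‖₊ + 1)) := by
    have hmem := spectrum.mem_resolventSet_of_norm_lt_mul (a := -S)
      (k := ((‖S‖₊ * ‖(1 : V →L[ℂ] V)‖₊ + 1 : NNReal) : ℂ)) <| by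
        rw [Complex.norm_real, NNReal.norm_eq, norm_neg]
        exact lt_add_one _
    simpa only [spectrum.mem_resolventSet_iff, sub_neg_eq_add, add_comm] using hmem
  have hzero : g 0 = S := by simp [g]
  exact hzero ▸ isUnit_of_preconnectedSpace_of_norm_inv_le hg hbound hlarge 0

variable [CompleteSpace X] [CompleteSpace Y] [CompleteSpace Z]

theorem exists_forall_exists_preimage_norm_le_of_isClosed_range (f : X →L[𝕜] Z)
    (hf : IsClosed (Set.range f)) :
    ∃ C > 0, ∀ x, ∃ x', f x' = f x ∧ ‖x'‖ ≤ C * ‖f x‖ := by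
  have : CompleteSpace f.range := IsClosed.completeSpace_coe (hs := hf)
  obtain ⟨C, hC₀, hC⟩ := f.rangeRestrict.exists_preimage_norm_le fun ⟨_, x, hx⟩ =>
    ⟨x, Subtype.ext hx⟩
  refine ⟨C, hC₀, fun x => ?_⟩
  obtain ⟨x', hx', hle⟩ := hC (f.rangeRestrict x)
  exact ⟨x', congrArg Subtype.val hx', hle⟩

theorem exists_forall_norm_le_mul_norm_add {f : X →L[𝕜] Z} {g : Y →L[𝕜] Z}
    (hfg : Disjoint f.range g.range) (hcl : IsClosed (Set.range f + Set.range g)) :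
    ∃ C > 0, ∀ x y, ‖f x‖ ≤ C * ‖f x + g y‖ := by
  have hrange : Set.range (f.coprod g) = Set.range f + Set.range g := by
    exact (congrArg SetLike.coe (f.range_coprod g)).trans (Submodule.coe_sup f.range g.range)
  obtain ⟨C, hC₀, hC⟩ := exists_forall_exists_preimage_norm_le_of_isClosed_range (f.coprod g)
    (hrange ▸ hcl)
  refine ⟨(‖f‖ + 1) * C, by positivity, fun x y => ?_⟩
  obtain ⟨⟨x', y'⟩, heq, hle⟩ := hC (x, y)
  simp only [ContinuousLinearMap.coprod_apply] at heq hle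
  have hx : f (x - x') = 0 := Submodule.disjoint_def.mp hfg _ ⟨_, rfl⟩
    ⟨y' - y, by simpa [sub_eq_sub_iff_add_eq_add, add_comm] using heq⟩
  calc ‖f x‖ = ‖f x'‖ := by rw [sub_eq_zero.mp ((map_sub f x x').symm.trans hx)]
    _ ≤ (‖f‖ + 1) * ‖x'‖ := f.le_of_opNorm_le (by linarith) x'
    _ ≤ (‖f‖ + 1) * (C * ‖f x + g y‖) := by gcongr; exact (norm_fst_le (x', y')).trans hle
    _ = (‖f‖ + 1) * C * ‖f x + g y‖ := (mul_assoc _ _ _).symm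

theorem isClosed_range_of_disjoint_of_isClosed_add {f : X →L[𝕜] Z} {g : Y →L[𝕜] Z}
    (hfg : Disjoint f.range g.range) (hcl : IsClosed (Set.range f + Set.range g)) :
    IsClosed (Set.range f) := by
  obtain ⟨C, -, hC⟩ := exists_forall_norm_le_mul_norm_add hfg hcl
  refine isClosed_of_closure_subset fun z hz => ?_
  have hsub : Set.range f ⊆ Set.range f + Set.range g :=
    Set.subset_add_left _ ⟨0, map_zero g⟩
  obtain ⟨_, ⟨x, rfl⟩, _, ⟨y, rfl⟩, rfl⟩ := hcl.closure_subset_iff.mpr hsub hz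
  have hle : ∀ w ∈ Set.range f, ‖w - f x‖ ≤ C * ‖w - (f x + g y)‖ := by
    rintro _ ⟨x', rfl⟩
    simpa only [map_sub, map_neg, ← sub_eq_add_neg, sub_sub] using hC (x' - x) (-y)
  have hlim : ‖f x + g y - f x‖ ≤ C * ‖f x + g y - (f x + g y)‖ :=
    closure_minimal (t := {w | ‖w - f x‖ ≤ C * ‖w - (f x + g y)‖}) hle
      (isClosed_le (by fun_prop) (by fun_prop)) hz
  rw [sub_self, norm_zero, mul_zero, norm_le_zero_iff, sub_eq_zero] at hlim
  exact ⟨x, hlim.symm⟩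

end Banach

section HilbertModule

variable (𝔄 : Type*) {H : Type*} [NonUnitalCStarAlgebra 𝔄] [PartialOrder 𝔄] [StarOrderedRing 𝔄]
  [NormedAddCommGroup H] [NormedSpace ℂ H] [SMul 𝔄 H] [CStarModule 𝔄 H]

theorem norm_le_mul_norm_of_sq_norm_le_norm_inner {x y : H} {C : ℝ} (hC₀ : 0 ≤ C)
    (h : ‖x‖ ^ 2 ≤ C * ‖inner 𝔄 x y‖) : ‖x‖ ≤ C * ‖y‖ := by
  refine le_of_sq_le_mul (by positivity) (h.trans ?_)
  rw [mul_left_comm]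
  gcongr
  exact CStarModule.norm_inner_le H

theorem norm_inner_le_norm_inner_add_smul {x y : H} (hxy : 0 ≤ inner 𝔄 x y) (t : NNReal) :
    ‖inner 𝔄 x y‖ ≤ ‖inner 𝔄 x (y + (t : ℂ) • x)‖ := by
  refine CStarAlgebra.norm_le_norm_of_nonneg_of_le hxy ?_
  rw [CStarModule.inner_add_right, CStarModule.inner_smul_right_complex]
  refine le_add_of_nonneg_right ?_
  have hnn : (0 : 𝔄) ≤ (t : ℝ) • inner 𝔄 x x :=
    smul_nonneg t.2 CStarModule.inner_self_nonneg
  simpa using hnn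

theorem sq_norm_le_norm_inner_self_add_inner_self (x y : H) :
    ‖x‖ ^ 2 ≤ ‖inner 𝔄 x x + inner 𝔄 y y‖ := by
  rw [CStarModule.norm_sq_eq 𝔄]
  exact CStarAlgebra.norm_le_norm_of_nonneg_of_le CStarModule.inner_self_nonneg
    (le_add_of_nonneg_right CStarModule.inner_self_nonneg)

/-- Riesz representation fails in Hilbert modules, so the Lax–Milgram theorem is obtained by the
method of continuity along the path `S + t`, `0 ≤ t`, which stays coercive. -/
theorem surjOn_of_coercive {F : Submodule ℂ H} [CompleteSpace F] {S : H →L[ℂ] H}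
    (hSF : Set.MapsTo S F F) {C : ℝ} (hC₀ : 0 ≤ C) (hpos : ∀ x ∈ F, 0 ≤ inner 𝔄 x (S x))
    (hC : ∀ x ∈ F, ‖x‖ ^ 2 ≤ C * ‖inner 𝔄 x (S x)‖) : Set.SurjOn S F F := by
  have hbound (t : NNReal) (x : F) : ‖x‖ ≤ C * ‖S.restrict hSF x + (t : ℂ) • x‖ :=
    norm_le_mul_norm_of_sq_norm_le_norm_inner 𝔄 (x := (x : H)) (y := S x + (t : ℂ) • x) hC₀ <|
      (hC x x.2).trans <| by
        gcongr
        exact norm_inner_le_norm_inner_add_smul 𝔄 (hpos x x.2) t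
  obtain ⟨u, hu⟩ := isUnit_of_forall_norm_le_mul_norm_add_smul hC₀ hbound
  intro y hy
  have hy' : S.restrict hSF ((↑u⁻¹ : F →L[ℂ] F) ⟨y, hy⟩) = ⟨y, hy⟩ := by
    rw [← hu, ← mul_apply_eq_comp, Units.mul_inv, one_apply_eq_self]
  exact ⟨_, Subtype.property _, congrArg Subtype.val hy'⟩

end HilbertModule

/-- For idempotents `p` and `q` of a ring with `2 - p - q` invertible, an element `n` such that
`p * n = p` and `q * n = 0`. If `p` and `q` are the orthogonal projections onto `M` and `N`, then
the adjoint of `n` restricts to the projection of `M + N` onto `M` along `N`. -/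
noncomputable def obliqueSplit {R : Type*} [Ring R] (p q : R) : R :=
  (1 - q) * Ring.inverse (2 - p - q)

namespace obliqueSplit

variable {R : Type*} [Ring R] {p q r : R}

theorem eq_one_sub (hu : IsUnit (2 - p - q)) :
    obliqueSplit p q = 1 - (1 - p) * Ring.inverse (2 - p - q) := by
  have hsum : 1 - q = (2 - p - q) - (1 - p) := by rw [← one_add_one_eq_two]; abel
  rw [obliqueSplit, hsum, sub_mul, Ring.mul_inverse_cancel _ hu]

theorem left_mul_eq_left (hp : IsIdempotentElem p) (hu : IsUnit (2 - p - q)) :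
    p * obliqueSplit p q = p := by
  rw [eq_one_sub hu, mul_sub, ← mul_assoc, hp.mul_one_sub_self, zero_mul, mul_one, sub_zero]

theorem right_mul_eq_zero (hq : IsIdempotentElem q) : q * obliqueSplit p q = 0 := by
  rw [obliqueSplit, ← mul_assoc, hq.mul_one_sub_self, zero_mul]

theorem commute (hu : IsUnit (2 - p - q)) (hrp : Commute r p) (hrq : Commute r q) :
    Commute r (obliqueSplit p q) := by
  have hinv : Commute r (Ring.inverse (2 - p - q)) := by
    have hcomm : Commute r (2 - p - q) := ((Commute.ofNat_right r 2).sub_right hrp).sub_right hrq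
    obtain ⟨u, hu⟩ := hu
    rw [← hu] at hcomm ⊢
    rw [Ring.inverse_unit]
    exact hcomm.units_inv_right
  exact ((Commute.one_right r).sub_right hrq).mul_right hinv

theorem add_mul_eq_left {g₁ g₂ : R} (hp : IsIdempotentElem p) (hq : IsIdempotentElem q)
    (hu : IsUnit (2 - p - q)) (h₁ : g₁ * p = g₁) (h₂ : g₂ * q = g₂) :
    (g₁ + g₂) * obliqueSplit p q = g₁ := by
  rw [add_mul, ← h₁, ← h₂, mul_assoc, mul_assoc, left_mul_eq_left hp hu, right_mul_eq_zero hq,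
    mul_zero, add_zero]

theorem mul_eq_mul_of_commute {g₁ g₂ y : R} (hp : IsIdempotentElem p) (hq : IsIdempotentElem q)
    (hu : IsUnit (2 - p - q)) (h₁ : g₁ * p = g₁) (h₂ : g₂ * q = g₂)
    (hyp : y * (g₁ + g₂) * p = p) (hcp : Commute (y * (g₁ + g₂)) p)
    (hcq : Commute (y * (g₁ + g₂)) q) : y * g₁ = obliqueSplit p q * p := by
  calc y * g₁ = y * ((g₁ + g₂) * obliqueSplit p q) * p := by
        rw [add_mul_eq_left hp hq hu h₁ h₂, mul_assoc, h₁]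
    _ = obliqueSplit p q * (y * (g₁ + g₂)) * p := by
        rw [← mul_assoc, (commute hu hcp hcq).eq]
    _ = obliqueSplit p q * p := by rw [mul_assoc, hyp]

end obliqueSplit

namespace AdjointableMap

section Algebra

variable {𝔄 H K E : Type*} [NonUnitalCStarAlgebra 𝔄] [PartialOrder 𝔄]
  [NormedAddCommGroup H] [NormedSpace ℂ H] [SMul 𝔄 H] [CStarModule 𝔄 H]
  [NormedAddCommGroup K] [NormedSpace ℂ K] [SMul 𝔄 K] [CStarModule 𝔄 K]
  [NormedAddCommGroup E] [NormedSpace ℂ E] [SMul 𝔄 E] [CStarModule 𝔄 E]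

theorem map_sub (T : AdjointableMap 𝔄 H K) (x y : H) : T (x - y) = T x - T y := by
  rw [sub_eq_add_neg, map_add, map_neg, ← sub_eq_add_neg]

theorem sub_comp (S T : AdjointableMap 𝔄 K E) (U : AdjointableMap 𝔄 H K) :
    (S - T) ∘ₐ U = S ∘ₐ U - T ∘ₐ U :=
  ext fun x => by simp only [sub_apply, comp_apply]

theorem apply_eq_of_adjoint_apply_eq (T : AdjointableMap 𝔄 H K) {x y : H}
    (h : T.adjoint (T x) = T.adjoint (T y)) : T x = T y := by
  refine sub_eq_zero.mp ((CStarModule.inner_self (A := 𝔄)).mp ?_)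
  rw [← map_sub, inner_left, map_sub, map_sub, h, sub_self, CStarModule.inner_zero_right]

theorem inner_apply_self_of_isStarProjection {P : AdjointableMap 𝔄 H H} (hP : IsStarProjection P)
    (x : H) : inner 𝔄 x (P x) = inner 𝔄 (P x) (P x) := by
  rw [inner_left, ← star_eq_adjoint, hP.isSelfAdjoint.star_eq, ← mul_apply,
    hP.isIdempotentElem.eq]

theorem isUnit_of_surjective {D : AdjointableMap 𝔄 H H} (hD : IsSelfAdjoint D)
    (hsurj : Function.Surjective D) : IsUnit D := by
  obtain ⟨g, hg⟩ := hsurj.hasRightInverse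
  have hinner (x y : H) : inner 𝔄 (D x) y = inner 𝔄 x (D y) := by
    rw [inner_left, ← star_eq_adjoint, hD.star_eq]
  have hginner (x y : H) : inner 𝔄 (g x) y = inner 𝔄 x (g y) := by
    simpa only [hg y, hg x] using (hinner (g x) (g y)).symm
  let X : AdjointableMap 𝔄 H H := ⟨g, g, hginner⟩
  have hDX : D * X = 1 := ext hg
  have hXD : X * D = 1 := by
    have hstar : star X = X := rfl
    simpa only [star_mul, hD.star_eq, hstar, star_one] using congrArg star hDX
  exact ⟨⟨D, X, hDX, hXD⟩, rfl⟩

theorem comp_eq_of_range_subset {P : AdjointableMap 𝔄 H H} {S : AdjointableMap 𝔄 K H}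
    (hP : IsIdempotentElem P) (h : Set.range S ⊆ Set.range P) : P ∘ₐ S = S := by
  ext k
  obtain ⟨x, hx⟩ := h ⟨k, rfl⟩
  rw [comp_apply, ← hx, ← mul_apply, hP.eq]

theorem isMPInvertible_of_forall_exists (T : AdjointableMap 𝔄 H K)
    (hT : ∀ x, ∃ x', T (T.adjoint (T x')) = T x) : T.IsMPInvertible := by
  choose g hg using hT
  have hfix (y : K) : T.adjoint (T (g (T.adjoint y))) = T.adjoint y :=
    T.adjoint.apply_eq_of_adjoint_apply_eq (hg (T.adjoint y))
  -- `g` inverts `T⋆ T` modulo the kernel of `T`, so `X` is `(T⋆ T) (T⋆ T)†² T⋆ = (T⋆ T)† T⋆`.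
  let X : AdjointableMap 𝔄 K H :=
    { toFun := fun y => T.adjoint (T (g (g (T.adjoint y))))
      adjFun := fun x => T (g x)
      inner_toFun := fun y x => by
        calc inner 𝔄 (T.adjoint (T (g (g (T.adjoint y))))) x
            = inner 𝔄 (T (g (g (T.adjoint y)))) (T (T.adjoint (T (g x)))) := by
              rw [hg, T.inner_right]
          _ = inner 𝔄 (T (T.adjoint (T (g (g (T.adjoint y)))))) (T (g x)) := by
              rw [T.inner_right, ← T.inner_left]
          _ = inner 𝔄 y (T (g x)) := by
              rw [hg, T.inner_right, hfix, ← T.inner_right] }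
  have hTX (y : K) : T (X y) = T (g (T.adjoint y)) := hg _
  have hTXT (x : H) : T (X (T x)) = T x :=
    (hTX _).trans (T.apply_eq_of_adjoint_apply_eq (hfix (T x)))
  refine ⟨X, ext hTXT, ext fun y => ?_, ext fun y => (hTX y).symm, ext fun x => ?_⟩
  · change T.adjoint (T (g (g (T.adjoint (T (X y)))))) = T.adjoint (T (g (g (T.adjoint y))))
    rw [hTX, hfix]
  · exact T.adjoint.apply_eq_of_adjoint_apply_eq ((hg x).trans (hTXT x).symm)

namespace IsMPInverse

variable {T : AdjointableMap 𝔄 H K} {X : AdjointableMap 𝔄 K H}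

protected theorem adjoint (h : T.IsMPInverse X) : T.adjoint.IsMPInverse X.adjoint where
  comp_comp_self := congrArg AdjointableMap.adjoint h.comp_comp_self
  self_comp_comp := congrArg AdjointableMap.adjoint h.self_comp_comp
  adjoint_comp_right := congrArg AdjointableMap.adjoint h.adjoint_comp_left
  adjoint_comp_left := congrArg AdjointableMap.adjoint h.adjoint_comp_right

theorem isStarProjection_comp_left (h : T.IsMPInverse X) : IsStarProjection (X ∘ₐ T) where
  isIdempotentElem := congrArg (X ∘ₐ ·) h.comp_comp_self
  isSelfAdjoint := h.adjoint_comp_left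

theorem isStarProjection_comp_right (h : T.IsMPInverse X) : IsStarProjection (T ∘ₐ X) where
  isIdempotentElem := congrArg (T ∘ₐ ·) h.self_comp_comp
  isSelfAdjoint := h.adjoint_comp_right

theorem range_comp_right (h : T.IsMPInverse X) : Set.range (T ∘ₐ X) = Set.range T :=
  (Set.range_comp_subset_range X T).antisymm <| by
    nth_rw 1 [← h.comp_comp_self]
    exact Set.range_comp_subset_range T (T ∘ₐ X)

theorem range_comp_left (h : T.IsMPInverse X) : Set.range (X ∘ₐ T) = Set.range T.adjoint := by
  rw [← h.adjoint.range_comp_right, ← adjoint_comp, h.adjoint_comp_left]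

theorem range_eq (h : T.IsMPInverse X) : Set.range X = Set.range T.adjoint := by
  rw [← h.range_comp_left]
  refine Set.Subset.antisymm ?_ (Set.range_comp_subset_range T X)
  nth_rw 1 [← h.self_comp_comp]
  exact Set.range_comp_subset_range X (X ∘ₐ T)

theorem range_adjoint_comp_self (h : T.IsMPInverse X) :
    Set.range (T.adjoint ∘ₐ T) = Set.range T.adjoint := by
  have hadj : (T.adjoint ∘ₐ T) ∘ₐ X = T.adjoint := by
    rw [comp_assoc, ← h.adjoint_comp_right]
    exact h.adjoint.comp_comp_self
  refine (Set.range_comp_subset_range T T.adjoint).antisymm ?_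
  nth_rw 1 [← hadj]
  exact Set.range_comp_subset_range X (T.adjoint ∘ₐ T)

end IsMPInverse

theorem IsMPInvertible.of_adjoint {T : AdjointableMap 𝔄 H K} (h : T.adjoint.IsMPInvertible) :
    T.IsMPInvertible :=
  ⟨_, h.isMPInverse_mpInv.adjoint⟩

theorem IsPosDef.exists_eq_adjoint_comp_self {V : AdjointableMap 𝔄 K K} (hV : V.IsPosDef) :
    ∃ S : AdjointableMap 𝔄 K K, V = S.adjoint ∘ₐ S ∧ Function.Surjective S.adjoint := by
  obtain ⟨S, hS⟩ := hV.isPositive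
  obtain ⟨u, hu⟩ := hV.isUnit
  have hright : star S * (S * ↑u⁻¹) = 1 := by rw [← mul_assoc, ← hS, ← hu, Units.mul_inv]
  exact ⟨S, hS, fun y => ⟨_, congrArg (· y) hright⟩⟩

theorem IsSeparatedPair.symm {A : AdjointableMap 𝔄 H K} {B : AdjointableMap 𝔄 H E}
    (h : A.IsSeparatedPair B) : B.IsSeparatedPair A :=
  ⟨by rw [Set.inter_comm, h.1], by rw [add_comm]; exact h.2⟩

theorem isSelfAdjoint_adjoint_comp_comp {V : AdjointableMap 𝔄 K K} (hV : IsSelfAdjoint V)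
    (A : AdjointableMap 𝔄 H K) : IsSelfAdjoint (A.adjoint ∘ₐ V ∘ₐ A) :=
  congrArg (fun U => A.adjoint ∘ₐ U ∘ₐ A) hV.star_eq

section Oblique

variable {P Q G₁ G₂ : AdjointableMap 𝔄 H H}

theorem mul_eq_self_of_range_subset (hP : IsStarProjection P) (hG : IsSelfAdjoint G₁)
    (h : Set.range G₁ ⊆ Set.range P) : G₁ * P = G₁ := by
  have hPG : P * G₁ = G₁ := comp_eq_of_range_subset hP.isIdempotentElem h
  simpa only [star_mul, hG.star_eq, hP.isSelfAdjoint.star_eq] using congrArg star hPG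

theorem range_add_eq (hP : IsStarProjection P) (hQ : IsStarProjection Q)
    (hu : IsUnit (2 - P - Q)) (hG₁ : IsSelfAdjoint G₁) (hG₂ : IsSelfAdjoint G₂)
    (h₁ : Set.range G₁ ⊆ Set.range P) (h₂ : Set.range G₂ ⊆ Set.range Q) :
    Set.range (G₁ + G₂) = Set.range G₁ + Set.range G₂ := by
  have hsplit : (G₁ + G₂) * obliqueSplit P Q = G₁ :=
    obliqueSplit.add_mul_eq_left hP.isIdempotentElem hQ.isIdempotentElem hu
      (mul_eq_self_of_range_subset hP hG₁ h₁) (mul_eq_self_of_range_subset hQ hG₂ h₂)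
  have hcosplit : (G₁ + G₂) * (1 - obliqueSplit P Q) = G₂ := by
    rw [mul_sub, mul_one, hsplit, add_sub_cancel_left]
  refine Set.Subset.antisymm ?_ ?_
  · rintro _ ⟨x, rfl⟩
    exact Set.add_mem_add ⟨x, rfl⟩ ⟨x, rfl⟩
  · rintro _ ⟨_, ⟨x, rfl⟩, _, ⟨y, rfl⟩, rfl⟩
    refine ⟨obliqueSplit P Q x + (1 - obliqueSplit P Q) y, ?_⟩
    rw [map_add, ← mul_apply, ← mul_apply, hsplit, hcosplit]

theorem commute_of_range_subset (hP : IsStarProjection P) (hQ : IsStarProjection Q)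
    (h : Set.range Q ⊆ Set.range P) : Commute P Q := by
  have hPQ : P * Q = Q := comp_eq_of_range_subset hP.isIdempotentElem h
  exact hPQ.trans (mul_eq_self_of_range_subset hP hQ.isSelfAdjoint h).symm

theorem mpInv_add_comp (hP : IsStarProjection P) (hQ : IsStarProjection Q)
    (hu : IsUnit (2 - P - Q)) (hG₁ : IsSelfAdjoint G₁) (hG₂ : IsSelfAdjoint G₂)
    (h₁ : Set.range G₁ = Set.range P) (h₂ : Set.range G₂ = Set.range Q)
    (hmp₁ : G₁.IsMPInvertible) (hmp : (G₁ + G₂).IsMPInvertible)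
    {S : AdjointableMap 𝔄 K H} (hS : Set.range S ⊆ Set.range G₁) :
    (G₁ + G₂).mpInv ∘ₐ S = obliqueSplit P Q ∘ₐ G₁.mpInv ∘ₐ S := by
  have hX := hmp₁.isMPInverse_mpInv
  have hY := hmp.isMPInverse_mpInv
  have hR : IsStarProjection ((G₁ + G₂).mpInv * (G₁ + G₂)) := hY.isStarProjection_comp_left
  have hrange : Set.range ((G₁ + G₂).mpInv * (G₁ + G₂)) = Set.range P + Set.range Q := by
    rw [mul_eq_comp, hY.range_comp_left, ← star_eq_adjoint, (hG₁.add hG₂).star_eq,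
      range_add_eq hP hQ hu hG₁ hG₂ h₁.subset h₂.subset, h₁, h₂]
  have hPR : Set.range P ⊆ Set.range ((G₁ + G₂).mpInv * (G₁ + G₂)) :=
    hrange ▸ Set.subset_add_left _ ⟨0, Q.map_zero⟩
  have hQR : Set.range Q ⊆ Set.range ((G₁ + G₂).mpInv * (G₁ + G₂)) :=
    hrange ▸ Set.subset_add_right _ ⟨0, P.map_zero⟩
  have hleft : (G₁ + G₂).mpInv * G₁ = obliqueSplit P Q * P :=
    obliqueSplit.mul_eq_mul_of_commute hP.isIdempotentElem hQ.isIdempotentElem hu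
      (mul_eq_self_of_range_subset hP hG₁ h₁.subset) (mul_eq_self_of_range_subset hQ hG₂ h₂.subset)
      (comp_eq_of_range_subset hR.isIdempotentElem hPR)
      (commute_of_range_subset hR hP hPR) (commute_of_range_subset hR hQ hQR)
  have hPX : P ∘ₐ G₁.mpInv = G₁.mpInv := comp_eq_of_range_subset hP.isIdempotentElem <| by
    rw [hX.range_eq, ← star_eq_adjoint, hG₁.star_eq, h₁]
  have hGXS : (G₁ ∘ₐ G₁.mpInv) ∘ₐ S = S :=
    comp_eq_of_range_subset hX.isStarProjection_comp_right.isIdempotentElem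
      (hX.range_comp_right ▸ hS)
  calc (G₁ + G₂).mpInv ∘ₐ S = ((G₁ + G₂).mpInv * G₁) ∘ₐ G₁.mpInv ∘ₐ S := by
        nth_rw 1 [← hGXS]; rfl
    _ = obliqueSplit P Q ∘ₐ (P ∘ₐ G₁.mpInv) ∘ₐ S := by rw [hleft]; rfl
    _ = obliqueSplit P Q ∘ₐ G₁.mpInv ∘ₐ S := by rw [hPX]

end Oblique

end Algebra

section Complete

variable {𝔄 H K E : Type*} [NonUnitalCStarAlgebra 𝔄] [PartialOrder 𝔄] [StarOrderedRing 𝔄]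
  [NormedAddCommGroup H] [NormedSpace ℂ H] [SMul 𝔄 H] [CStarModule 𝔄 H]
  [NormedAddCommGroup K] [NormedSpace ℂ K] [SMul 𝔄 K] [CStarModule 𝔄 K]
  [NormedAddCommGroup E] [NormedSpace ℂ E] [SMul 𝔄 E] [CStarModule 𝔄 E]

/-- An adjointable operator as a `ℂ`-linear map, the input of the closed graph theorem. -/
def toLinearMap (T : AdjointableMap 𝔄 H K) : H →ₗ[ℂ] K where
  toFun := T
  map_add' := T.map_add
  map_smul' := T.map_smul_complex

variable [CompleteSpace H] [CompleteSpace K]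

protected theorem continuous (T : AdjointableMap 𝔄 H K) : Continuous T := by
  refine T.toLinearMap.continuous_of_seq_closed_graph fun u x y hu hTu => ?_
  refine eq_of_inner_left 𝔄 fun z => ?_
  have hleft := ((CStarModule.innerSL (A := 𝔄) z).continuous.tendsto y).comp hTu
  have hright := ((CStarModule.innerSL (A := 𝔄) (T.adjoint z)).continuous.tendsto x).comp hu
  refine (tendsto_nhds_unique hleft (hright.congr fun n => ?_)).trans (T.inner_right z x).symm
  exact (T.inner_right z (u n)).symm

/-- An adjointable operator between complete Hilbert modules as a bounded operator, which gives
access to the open mapping theorem. -/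
def toCLM (T : AdjointableMap 𝔄 H K) : H →L[ℂ] K where
  toLinearMap := T.toLinearMap
  cont := T.continuous

theorem isMPInvertible_of_isClosed_range (T : AdjointableMap 𝔄 H K)
    (hT : IsClosed (Set.range T)) : T.IsMPInvertible := by
  obtain ⟨C, hC₀, hC⟩ := exists_forall_exists_preimage_norm_le_of_isClosed_range T.toCLM hT
  have : CompleteSpace T.toCLM.range := IsClosed.completeSpace_coe (hs := hT)
  have hadj (x : H) : ‖T x‖ ≤ C * ‖T.adjoint (T x)‖ := by
    obtain ⟨x', hx', hle⟩ : ∃ x', T x' = T x ∧ ‖x'‖ ≤ C * ‖T x‖ := hC x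
    refine le_of_sq_le_mul (by positivity) ?_
    calc ‖T x‖ ^ 2 = ‖inner 𝔄 x' (T.adjoint (T x))‖ := by
          rw [← T.inner_left, hx', CStarModule.norm_sq_eq 𝔄]
      _ ≤ ‖x'‖ * ‖T.adjoint (T x)‖ := CStarModule.norm_inner_le H
      _ ≤ C * ‖T x‖ * ‖T.adjoint (T x)‖ := by gcongr
      _ = ‖T x‖ * (C * ‖T.adjoint (T x)‖) := by ring
  have hinner (y : K) : inner 𝔄 y ((T ∘ₐ T.adjoint) y) = inner 𝔄 (T.adjoint y) (T.adjoint y) :=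
    T.inner_right y (T.adjoint y)
  have hsurj : Set.SurjOn (T ∘ₐ T.adjoint).toCLM T.toCLM.range T.toCLM.range := by
    refine surjOn_of_coercive 𝔄 (C := C ^ 2) (fun y _ => ⟨_, rfl⟩) (by positivity) ?_ ?_
    · exact fun y _ => (hinner y).symm ▸ CStarModule.inner_self_nonneg
    · rintro _ ⟨x, rfl⟩
      calc ‖T x‖ ^ 2 ≤ (C * ‖T.adjoint (T x)‖) ^ 2 := by gcongr; exact hadj x
        _ = C ^ 2 * ‖inner 𝔄 (T x) ((T ∘ₐ T.adjoint) (T x))‖ := by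
          rw [hinner, mul_pow, CStarModule.norm_sq_eq 𝔄]
  refine T.isMPInvertible_of_forall_exists fun x => ?_
  obtain ⟨_, ⟨x', rfl⟩, hx'⟩ := hsurj ⟨x, rfl⟩
  exact ⟨x', hx'⟩

theorem isUnit_of_coercive {D : AdjointableMap 𝔄 H H} (hD : IsSelfAdjoint D)
    {C : ℝ} (hC₀ : 0 ≤ C) (hpos : ∀ x, 0 ≤ inner 𝔄 x (D x))
    (hC : ∀ x, ‖x‖ ^ 2 ≤ C * ‖inner 𝔄 x (D x)‖) : IsUnit D := by
  have : CompleteSpace (⊤ : Submodule ℂ H) := isClosed_univ.completeSpace_coe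
  have hsurj : Set.SurjOn D.toCLM (⊤ : Submodule ℂ H) (⊤ : Submodule ℂ H) :=
    surjOn_of_coercive 𝔄 (Set.mapsTo_univ _ _) hC₀ (fun x _ => hpos x) fun x _ => hC x
  exact isUnit_of_surjective hD (Set.surjOn_univ.mp hsurj)

theorem isUnit_two_sub_sub {P Q : AdjointableMap 𝔄 H H}
    (hP : IsStarProjection P) (hQ : IsStarProjection Q) {C : ℝ} (hC₀ : 0 ≤ C)
    (hC : ∀ x, ‖P x‖ ≤ C * ‖P x - Q x‖) : IsUnit (2 - P - Q) := by
  have hDeq : 2 - P - Q = (1 - P) + (1 - Q) := by rw [← one_add_one_eq_two]; abel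
  have hinner (x : H) : inner 𝔄 x ((2 - P - Q) x) =
      inner 𝔄 ((1 - P) x) ((1 - P) x) + inner 𝔄 ((1 - Q) x) ((1 - Q) x) := by
    rw [hDeq, add_apply, CStarModule.inner_add_right,
      inner_apply_self_of_isStarProjection hP.one_sub,
      inner_apply_self_of_isStarProjection hQ.one_sub]
  have hD : IsSelfAdjoint (2 - P - Q) :=
    hDeq ▸ hP.one_sub.isSelfAdjoint.add hQ.one_sub.isSelfAdjoint
  refine isUnit_of_coercive hD (C := (1 + C + C) ^ 2) (by positivity) (fun x => ?_) fun x => ?_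
  · rw [hinner]
    exact add_nonneg CStarModule.inner_self_nonneg CStarModule.inner_self_nonneg
  rw [hinner]
  set m := ‖inner 𝔄 ((1 - P) x) ((1 - P) x) + inner 𝔄 ((1 - Q) x) ((1 - Q) x)‖ with hm
  have hPm : ‖(1 - P) x‖ ≤ √m :=
    Real.le_sqrt_of_sq_le (sq_norm_le_norm_inner_self_add_inner_self 𝔄 _ _)
  have hQm : ‖(1 - Q) x‖ ≤ √m := Real.le_sqrt_of_sq_le <| by
    rw [hm, add_comm]
    exact sq_norm_le_norm_inner_self_add_inner_self 𝔄 _ _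
  have hx : ‖x‖ ≤ (1 + C + C) * √m :=
    calc ‖x‖ ≤ (1 + C) * ‖(1 - P) x‖ + C * ‖(1 - Q) x‖ := by
          simpa only [sub_apply, one_apply] using norm_le_of_norm_le_mul_norm_sub hC₀ (hC x) x
      _ ≤ (1 + C) * √m + C * √m := by gcongr
      _ = (1 + C + C) * √m := (add_mul _ _ _).symm
  calc ‖x‖ ^ 2 ≤ ((1 + C + C) * √m) ^ 2 := by gcongr
    _ = (1 + C + C) ^ 2 * m := by rw [mul_pow, Real.sq_sqrt (norm_nonneg _)]

theorem IsPosDef.range_adjoint_comp_comp {V : AdjointableMap 𝔄 K K} (hV : V.IsPosDef)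
    {A : AdjointableMap 𝔄 H K} (hA : IsClosed (Set.range A.adjoint)) :
    Set.range (A.adjoint ∘ₐ V ∘ₐ A) = Set.range A.adjoint := by
  obtain ⟨S, rfl, hS⟩ := hV.exists_eq_adjoint_comp_self
  have hSA : Set.range (S ∘ₐ A).adjoint = Set.range A.adjoint := hS.range_comp A.adjoint
  have hmp : (S ∘ₐ A).IsMPInvertible :=
    (isMPInvertible_of_isClosed_range _ (hSA ▸ hA)).of_adjoint
  exact hmp.isMPInverse_mpInv.range_adjoint_comp_self.trans hSA

namespace IsSeparatedPair

variable {A : AdjointableMap 𝔄 H K} {B : AdjointableMap 𝔄 H E}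
  [CompleteSpace E]

theorem disjoint_range (h : A.IsSeparatedPair B) :
    Disjoint A.adjoint.toCLM.range B.adjoint.toCLM.range :=
  Submodule.disjoint_def.mpr fun _ hA hB => h.1.subset ⟨hA, hB⟩

theorem isClosed_range_left (h : A.IsSeparatedPair B) : IsClosed (Set.range A.adjoint) :=
  isClosed_range_of_disjoint_of_isClosed_add h.disjoint_range h.2

theorem isMPInvertible_left (h : A.IsSeparatedPair B) : A.IsMPInvertible :=
  (isMPInvertible_of_isClosed_range _ h.isClosed_range_left).of_adjoint

theorem isUnit_two_sub_sub_comp (h : A.IsSeparatedPair B) {X : AdjointableMap 𝔄 K H}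
    {Y : AdjointableMap 𝔄 E H} (hX : A.IsMPInverse X) (hY : B.IsMPInverse Y) :
    IsUnit (2 - X ∘ₐ A - Y ∘ₐ B) := by
  obtain ⟨C, hC₀, hC⟩ := exists_forall_norm_le_mul_norm_add h.disjoint_range h.2
  refine isUnit_two_sub_sub hX.isStarProjection_comp_left hY.isStarProjection_comp_left hC₀.le
    fun x => ?_
  have hx : ‖A.adjoint (X.adjoint x)‖ ≤
      C * ‖A.adjoint (X.adjoint x) + B.adjoint (-Y.adjoint x)‖ := hC _ _
  rw [← hX.adjoint_comp_left, ← hY.adjoint_comp_left]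
  rwa [map_neg, ← sub_eq_add_neg] at hx

end IsSeparatedPair

end Complete

end AdjointableMap

theorem mainTheorem8 {𝔄 H K E : Type*}
    [NonUnitalCStarAlgebra 𝔄] [PartialOrder 𝔄] [StarOrderedRing 𝔄]
    [NormedAddCommGroup H] [NormedSpace ℂ H] [SMul 𝔄 H] [CStarModule 𝔄 H] [CompleteSpace H]
    [NormedAddCommGroup K] [NormedSpace ℂ K] [SMul 𝔄 K] [CStarModule 𝔄 K] [CompleteSpace K]
    [NormedAddCommGroup E] [NormedSpace ℂ E] [SMul 𝔄 E] [CStarModule 𝔄 E] [CompleteSpace E]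
    (A : AdjointableMap 𝔄 H K) (B : AdjointableMap 𝔄 H E) (hAB : A.IsSeparatedPair B)
    (V : AdjointableMap 𝔄 K K) (hV : V.IsPosDef)
    (W : AdjointableMap 𝔄 E E) (hW : W.IsPosDef) :
    A.IsMPInvertible ∧ B.IsMPInvertible ∧
    (A.adjoint ∘ₐ V ∘ₐ A).IsMPInvertible ∧
    (A.adjoint ∘ₐ V ∘ₐ A + B.adjoint ∘ₐ W ∘ₐ B).IsMPInvertible ∧
    IsUnit (2 - A.mpInv ∘ₐ A - B.mpInv ∘ₐ B) ∧
    ∀ Pi : AdjointableMap 𝔄 K H,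
      Pi = Ring.inverse (2 - A.mpInv ∘ₐ A - B.mpInv ∘ₐ B) ∘ₐ
          (A.adjoint ∘ₐ V ∘ₐ A).mpInv ∘ₐ A.adjoint ∘ₐ V →
      (A.adjoint ∘ₐ V ∘ₐ A + B.adjoint ∘ₐ W ∘ₐ B).mpInv ∘ₐ A.adjoint ∘ₐ V =
        (A.adjoint ∘ₐ V ∘ₐ A).mpInv ∘ₐ A.adjoint ∘ₐ V - (1 - A.mpInv ∘ₐ A) ∘ₐ Pi := by
  have hA := hAB.isMPInvertible_left
  have hB := hAB.symm.isMPInvertible_left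
  have hu := hAB.isUnit_two_sub_sub_comp hA.isMPInverse_mpInv hB.isMPInverse_mpInv
  have hP := hA.isMPInverse_mpInv.isStarProjection_comp_left
  have hQ := hB.isMPInverse_mpInv.isStarProjection_comp_left
  have hG₁ := AdjointableMap.isSelfAdjoint_adjoint_comp_comp hV.isSelfAdjoint A
  have hG₂ := AdjointableMap.isSelfAdjoint_adjoint_comp_comp hW.isSelfAdjoint B
  have hr₁ := hV.range_adjoint_comp_comp hAB.isClosed_range_left
  have hr₂ := hW.range_adjoint_comp_comp hAB.symm.isClosed_range_left
  have hr₁P := hr₁.trans hA.isMPInverse_mpInv.range_comp_left.symm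
  have hr₂Q := hr₂.trans hB.isMPInverse_mpInv.range_comp_left.symm
  have hmp₁ := AdjointableMap.isMPInvertible_of_isClosed_range _ (hr₁ ▸ hAB.isClosed_range_left)
  have hmp := AdjointableMap.isMPInvertible_of_isClosed_range
    (A.adjoint ∘ₐ V ∘ₐ A + B.adjoint ∘ₐ W ∘ₐ B) <| by
      rw [AdjointableMap.range_add_eq hP hQ hu hG₁ hG₂ hr₁P.subset hr₂Q.subset, hr₁, hr₂]
      exact hAB.2
  refine ⟨hA, hB, hmp₁, hmp, hu, ?_⟩
  rintro _ rfl
  have hS : Set.range (A.adjoint ∘ₐ V) ⊆ Set.range (A.adjoint ∘ₐ V ∘ₐ A) :=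
    hr₁ ▸ Set.range_comp_subset_range V A.adjoint
  rw [AdjointableMap.mpInv_add_comp hP hQ hu hG₁ hG₂ hr₁P hr₂Q hmp₁ hmp hS,
    obliqueSplit.eq_one_sub hu, AdjointableMap.sub_comp]
  rfl
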